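/- For an entire function $f\not\equiv 0$ and $r\ge 1$ put $T_f(r)=m_{1/f}(r)+N_{1/f}(r)$, where \[ m_{1/f}(r)=\int_0^{2\pi}\log^+\frac{1}{|f(re^{i\theta})|}\,d\theta ,\qquad N_{1/f}(r)=\mathrm{ord}_0(f)\log r+\sum_{a\in\mathbb C\setminus\{0\}}\mathrm{ord}_a(f)\,\log^+\left|\frac{r}{a}\right| , \] $\log^+x=\max(\log x,0)$ and $\mathrm{ord}_a(f)$ is the order of vanishing of $f$ at $a$. (If $f(0)\neq 0$, the term $\mathrm{ord}_0(f)\log r$ is absent.) An entire function $f$ is called Brody if its spherical derivative $f^\#(z)=\frac{|f'(z)|}{1+|f(z)|^2}$ is bounded on $\mathbb C$. Theorem. Let $\rho:[1,\infty)\to(0,\infty)$ be a continuous increasing (not necessarily strictly increasing) function. 1. If $\liminf_{t\to\infty}\frac{\rho(t)}{\log t}<\infty$, then every entire function $f\not\equiv 0$ with $T_f(r)\le\rho(r)$ for all $r\ge 1$ is a polynomial. 2. If $\liminf_{t\to\infty}\frac{\rho(t)}{\log t}=\infty$, then there exists an entire function $f$ with $f(0)\ne 0$ which is not Brody and satisfies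 $T_f(r)\le\rho(r)$ for all $r\ge 1$. -/

import Mathlib

/-- The spherical derivative `f^#(z) = |f'(z)| / (1 + |f(z)|²)` of an entire function. -/
noncomputable def sphericalDeriv (f : ℂ → ℂ) (z : ℂ) : ℝ :=
  ‖deriv f z‖ / (1 + ‖f z‖ ^ 2)

/-- An entire function is Brody if its spherical derivative is bounded on `ℂ`. -/
def IsBrody (f : ℂ → ℂ) : Prop :=
  BddAbove (Set.range (sphericalDeriv f))

/-- `m_{1/f}(r) = ∫₀^{2π} log⁺ (1 / |f(r e^{iθ})|) dθ`. -/
noncomputable def nevanlinnaM (f : ℂ → ℂ) (r : ℝ) : ℝ :=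
  ∫ θ in (0 : ℝ)..(2 * Real.pi),
    Real.posLog (1 / ‖f ((r : ℂ) * Complex.exp ((θ : ℂ) * Complex.I))‖)

/-- `N_{1/f}(r) = ord₀(f) log r + ∑_{a ≠ 0} ord_a(f) log⁺ |r / a|`, the logarithmic counting
function of the zeros of `f`. The first term vanishes when `f 0 ≠ 0`. -/
noncomputable def nevanlinnaN (f : ℂ → ℂ) (r : ℝ) : ℝ :=
  ValueDistribution.logCounting f 0 r

/-- The characteristic function `T_f(r) = m_{1/f}(r) + N_{1/f}(r)`. -/
noncomputable def nevanlinnaT (f : ℂ → ℂ) (r : ℝ) : ℝ :=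
  nevanlinnaM f r + nevanlinnaN f r

/-!
`T_f` is compared with Mathlib's characteristic function: it lies between `characteristic f⁻¹ ⊤` and
`2π` times it, because the proximity integral in `T_f` is not divided by `2π`. The first main
theorem identifies `characteristic f⁻¹ ⊤` with `characteristic f ⊤` up to a constant.

If `ρ t / log t` stays bounded along a sequence `t → ∞`, then `characteristic f ⊤ t = O(log t)` along
it. The Poisson–Jensen inequality `log_norm_le_mul_proximity` turns this into polynomial growth of
`f` on the circles `‖z‖ = t / 4` (`norm_le_exp_of_characteristic`), and Cauchy's estimates kill all
but finitely many Taylor coefficients (`exists_polynomial_of_frequently_norm_le`).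

If `ρ t / log t → ∞`, the function is a product `f(z) = ∏ (1 - z / a n)` with positive zeros that
grow at least like `4 ^ n`. Since `f 0 = 1`, the first main theorem gives
`T_f(r) ≤ 2π ∑ log (1 + r / a n)`, and each summand can be made smaller than any prescribed fraction
of `ρ r`, for all `r ≥ 1` at once, by moving `a n` far out (`eventually_one_add_div_le_exp`).
Whatever the choice, `‖f' (a n)‖ ≥ a n / (8 * a 0 * a 1)` for `n ≥ 2`, so `f` has unbounded
spherical derivative on its zeros (`not_isBrody_lacunary`).
-/

/-! ### Comparison with the normalized characteristic function -/

open ValueDistribution in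
/-- The integral defining `m_{1/f}` lacks the factor `1 / (2π)` of the proximity function. -/
lemma nevanlinnaM_eq (f : ℂ → ℂ) (r : ℝ) :
    nevanlinnaM f r = 2 * Real.pi * proximity f 0 r := by
  rw [proximity_zero, Real.circleAverage, nevanlinnaM, smul_eq_mul,
    mul_inv_cancel_left₀ (by positivity)]
  simp [circleMap, one_div]

open ValueDistribution in
lemma characteristic_inv_eq (f : ℂ → ℂ) (r : ℝ) :
    characteristic f⁻¹ ⊤ r = proximity f 0 r + logCounting f 0 r := by
  simp [characteristic, proximity_inv]

open ValueDistribution in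
lemma characteristic_inv_le_nevanlinnaT (f : ℂ → ℂ) (r : ℝ) :
    characteristic f⁻¹ ⊤ r ≤ nevanlinnaT f r := by
  rw [characteristic_inv_eq, nevanlinnaT, nevanlinnaM_eq, nevanlinnaN]
  have := proximity_nonneg (f := f) (a := 0) r
  simp only [Pi.zero_apply] at this
  nlinarith [Real.pi_gt_three]

open ValueDistribution in
lemma nevanlinnaT_le_characteristic_inv (f : ℂ → ℂ) {r : ℝ} (hr : 1 ≤ r) :
    nevanlinnaT f r ≤ 2 * Real.pi * characteristic f⁻¹ ⊤ r := by
  rw [characteristic_inv_eq, nevanlinnaT, nevanlinnaM_eq, nevanlinnaN]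
  have := logCounting_nonneg (f := f) (e := 0) hr
  nlinarith [Real.pi_gt_three]

/-! ### A Poisson–Jensen inequality -/

lemma Complex.one_le_norm_canonicalFactor {R : ℝ} {u w : ℂ} (hu : u ∈ Metric.ball 0 R)
    (hw : w ∈ Metric.ball 0 R) (hne : w ≠ u) : 1 ≤ ‖canonicalFactor R u w‖ := by
  have hR : 0 < R := Metric.pos_of_mem_ball hu
  rw [mem_ball_zero_iff] at hu hw
  have h0 : 0 < ‖w - u‖ := norm_pos_iff.2 (sub_ne_zero.2 hne)
  rw [canonicalFactor_apply, norm_div, norm_mul, Complex.norm_real, Real.norm_of_nonneg hR.le,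
    one_le_div (by positivity), ← sq_le_sq₀ (by positivity) (by positivity), mul_pow,
    ← Complex.normSq_eq_norm_sq, ← Complex.normSq_eq_norm_sq]
  have h1 : Complex.normSq ((R : ℂ) ^ 2 - starRingEnd ℂ u * w) - R ^ 2 * Complex.normSq (w - u)
      = (R ^ 2 - Complex.normSq u) * (R ^ 2 - Complex.normSq w) := by
    simp only [Complex.normSq_apply, Complex.sub_re, Complex.sub_im, Complex.mul_re,
      Complex.mul_im, Complex.conj_re, Complex.conj_im, ← Complex.ofReal_pow, Complex.ofReal_re,
      Complex.ofReal_im]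
    ring
  have h2 : 0 ≤ (R ^ 2 - Complex.normSq u) * (R ^ 2 - Complex.normSq w) := by
    rw [Complex.normSq_eq_norm_sq, Complex.normSq_eq_norm_sq]
    apply mul_nonneg <;> nlinarith [norm_nonneg u, norm_nonneg w]
  linarith

/-- Poisson–Jensen inequality: dividing out a finite Blaschke product replaces `f` by a zero-free
function `h` with the same modulus on the circle and no smaller modulus inside, and the Poisson formula
applies to `log ‖h‖`. -/
lemma log_norm_le_mul_proximity {f : ℂ → ℂ} (hf : Differentiable ℂ f) {R : ℝ}
    (hfR : ∀ z ∈ Metric.sphere (0 : ℂ) R, f z ≠ 0) {w : ℂ} (hw : w ∈ Metric.ball 0 R)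
    (hfw : f w ≠ 0) :
    Real.log ‖f w‖ ≤ (R + ‖w‖) / (R - ‖w‖) * ValueDistribution.proximity f ⊤ R := by
  have hR : 0 < R := Metric.pos_of_mem_ball hw
  have hfa : AnalyticOnNhd ℂ f (Metric.closedBall 0 R) := fun z _ => hf.analyticAt z
  have hord (z : ℂ) (hz : f z ≠ 0) : meromorphicOrderAt f z = 0 :=
    (hf.analyticAt z).meromorphicNFAt.meromorphicOrderAt_eq_zero_iff.2 hz
  have htop : ∀ u : Metric.closedBall (0 : ℂ) R, meromorphicOrderAt f u ≠ ⊤ := by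
    rw [← hfa.meromorphicOn.exists_meromorphicOrderAt_ne_top_iff_forall
      (Metric.isConnected_closedBall hR.le)]
    exact ⟨⟨w, Metric.ball_subset_closedBall hw⟩, by simp [hord w hfw]⟩
  obtain ⟨h, D⟩ := hfa.meromorphicOn.exists_ecanonicalDecomp htop
  have hsph (z : ℂ) : MeromorphicOn.divisor f (Metric.sphere 0 R) z = 0 := by
    by_cases hz : z ∈ Metric.sphere (0 : ℂ) R
    · rw [MeromorphicOn.divisor_apply (hfa.meromorphicOn.mono_set Metric.sphere_subset_closedBall)
        hz, hord z (hfR z hz)]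
      rfl
    · exact Function.locallyFinsuppWithin.apply_eq_zero_of_notMem _ hz
  have hlog (z : ℂ) (hz : z ∈ Metric.closedBall (0 : ℂ) R) (hfz : f z ≠ 0) :
      Real.log ‖h z‖ = (∑ᶠ i, (MeromorphicOn.divisor f (Metric.ball 0 R) i : ℝ)
        * Real.log ‖Complex.canonicalFactor R i z‖) + Real.log ‖f z‖ := by
    rw [D.log_norm_eq hz (hord z hfz) hR,
      (hf.analyticAt z).meromorphicTrailingCoeffAt_of_ne_zero hfz]
    simp [hsph]
  have hin (i : ℂ) (hi : MeromorphicOn.divisor f (Metric.ball 0 R) i ≠ 0) :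
      i ∈ Metric.ball (0 : ℂ) R :=
    (MeromorphicOn.divisor f (Metric.ball 0 R)).supportWithinDomain hi
  have h_in : Real.log ‖f w‖ ≤ Real.log ‖h w‖ := by
    rw [hlog w (Metric.ball_subset_closedBall hw) hfw, le_add_iff_nonneg_left]
    refine finsum_nonneg fun i => ?_
    by_cases hi : MeromorphicOn.divisor f (Metric.ball 0 R) i = 0
    · simp [hi]
    refine mul_nonneg ?_ (Real.log_nonneg (Complex.one_le_norm_canonicalFactor (hin i hi) hw ?_))
    · exact_mod_cast MeromorphicOn.AnalyticOnNhd.divisor_nonneg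
        (hfa.mono Metric.ball_subset_closedBall) i
    · rintro rfl
      apply hi
      rw [MeromorphicOn.divisor_apply (hfa.meromorphicOn.mono_set Metric.ball_subset_closedBall)
        hw, hord w hfw]
      rfl
  have h_on (z : ℂ) (hz : z ∈ Metric.sphere (0 : ℂ) R) : Real.log ‖h z‖ = Real.log ‖f z‖ := by
    rw [hlog z (Metric.sphere_subset_closedBall hz) (hfR z hz), add_eq_right]
    refine finsum_eq_zero_of_forall_eq_zero fun i => ?_
    by_cases hi : MeromorphicOn.divisor f (Metric.ball 0 R) i = 0
    · simp [hi]
    · simp [Complex.norm_canonicalFactor_eval_circle_eq_one (hin i hi) hz]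
  have hharm : InnerProductSpace.HarmonicOnNhd (fun z => Real.log ‖h z‖) (Metric.closedBall 0 R) :=
    fun x hx => (D.analyticOnNhd x hx).harmonicAt_log_norm (D.ne_zero x hx)
  refine h_in.trans ?_
  rw [← hharm.circleAverage_re_herglotzRieszKernel_smul hw, ValueDistribution.proximity_top,
    ← smul_eq_mul, ← Real.circleAverage_smul]
  have hcont : ContinuousOn (fun z => Real.log ‖h z‖) (Metric.sphere 0 R) := by
    refine ContinuousOn.log ((D.analyticOnNhd.continuousOn.mono
      Metric.sphere_subset_closedBall).norm) fun z hz => ?_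
    exact norm_ne_zero_iff.2 (D.ne_zero z (Metric.sphere_subset_closedBall hz))
  have hker : ContinuousOn (Complex.re ∘ herglotzRieszKernel 0 w) (Metric.sphere 0 R) := by
    rw [herglotzRieszKernel_fun_def]
    refine Complex.continuous_re.comp_continuousOn (ContinuousOn.div (by fun_prop) (by fun_prop) ?_)
    intro z hz h0
    rw [sub_zero, sub_zero, sub_eq_zero] at h0
    subst h0
    rw [mem_ball_zero_iff] at hw
    rw [mem_sphere_zero_iff_norm] at hz
    exact hw.ne hz
  refine Real.circleAverage_mono ((hker.smul hcont).circleIntegrable hR.le) ?_ fun z hz => ?_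
  · refine Continuous.continuousOn ?_ |>.circleIntegrable hR.le
    have := hf.continuous
    exact continuous_const.smul (by fun_prop)
  · rw [abs_of_pos hR] at hz
    simp only [Pi.smul_apply', Pi.smul_apply, Function.comp_apply, smul_eq_mul, h_on z hz]
    have hle := re_herglotzRieszKernel_le hz hw
    have hge := le_re_herglotzRieszKernel hz hw
    rw [← herglotzRieszKernel_def] at hle hge
    rw [sub_zero] at hle hge
    have hwR : ‖w‖ < R := mem_ball_zero_iff.1 hw
    have h0 : 0 ≤ (herglotzRieszKernel 0 w z).re :=
      le_trans (div_nonneg (by linarith) (by positivity)) hge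
    calc _ ≤ (herglotzRieszKernel 0 w z).re * Real.posLog ‖f z‖ := by
          gcongr; exact le_max_right _ _
      _ ≤ _ := by gcongr; exact Real.posLog_nonneg

lemma exists_sphere_ne_zero {f : ℂ → ℂ} (hf : Differentiable ℂ f) (hf0 : ∃ z, f z ≠ 0) {a b : ℝ}
    (hab : a < b) : ∃ R ∈ Set.Ioo a b, ∀ z ∈ Metric.sphere (0 : ℂ) R, f z ≠ 0 := by
  obtain ⟨z₀, hz₀⟩ := hf0
  have hcod : f ⁻¹' {0}ᶜ ∈ Filter.codiscrete ℂ :=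
    AnalyticOnNhd.preimage_zero_mem_codiscrete (fun z _ => hf.analyticAt z) hz₀
  have hfin : (Metric.closedBall 0 b ∩ f ⁻¹' {0}).Finite := by
    refine ((isCompact_closedBall (0 : ℂ) b).inter_right
      (isClosed_singleton.preimage hf.continuous)).finite ?_
    exact (mem_codiscrete'.1 hcod).2.mono fun z hz h => h hz.2
  obtain ⟨R, hR, hR'⟩ := (Set.Ioo_infinite hab).exists_notMem_finite (hfin.image norm)
  refine ⟨R, hR, fun z hz h0 => hR' ⟨z, ⟨?_, h0⟩, ?_⟩⟩
  · rw [mem_sphere_zero_iff_norm] at hz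
    rw [mem_closedBall_zero_iff, hz]; exact hR.2.le
  · simpa using hz

open ValueDistribution in
lemma norm_le_exp_of_characteristic {f : ℂ → ℂ} (hf : Differentiable ℂ f) {t : ℝ} (ht : 2 < t)
    {w : ℂ} (hw : ‖w‖ ≤ t / 4) : ‖f w‖ ≤ Real.exp (3 * characteristic f ⊤ t) := by
  by_cases hfw : f w = 0
  · rw [hfw, norm_zero]; positivity
  -- `characteristic f ⊤` is monotone, so the radius may be decreased to avoid the zeros of `f`.
  obtain ⟨R, ⟨hR₁, hR₂⟩, hR⟩ := exists_sphere_ne_zero hf ⟨w, hfw⟩ (show t / 2 < t by linarith)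
  have hm : Meromorphic f := fun z => (hf.analyticAt z).meromorphicAt
  rw [← Real.log_le_iff_le_exp (norm_pos_iff.2 hfw)]
  have hp := proximity_nonneg (f := f) (a := ⊤) R
  simp only [Pi.zero_apply] at hp
  calc Real.log ‖f w‖ ≤ (R + ‖w‖) / (R - ‖w‖) * proximity f ⊤ R :=
        log_norm_le_mul_proximity hf hR (by rw [mem_ball_zero_iff]; linarith) hfw
    _ ≤ 3 * proximity f ⊤ R := by
        gcongr
        rw [div_le_iff₀ (by linarith)]
        linarith
    _ ≤ 3 * characteristic f ⊤ R := by
        have := logCounting_nonneg (f := f) (e := ⊤) (r := R) (by linarith)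
        simp only [characteristic, Pi.add_apply]
        linarith
    _ ≤ 3 * characteristic f ⊤ t := by
        gcongr
        exact characteristic_monotoneOn hm (Set.mem_Ioi.2 (by linarith))
          (Set.mem_Ioi.2 (by linarith)) hR₂.le

/-! ### Slow growth forces polynomials -/

open Filter Topology in
/-- A form of Liouville's theorem in which polynomial growth is only required on arbitrarily large
circles. -/
lemma exists_polynomial_of_frequently_norm_le {f : ℂ → ℂ} (hf : Differentiable ℂ f) {C : ℝ} {d : ℕ}
    (h : ∃ᶠ t : ℝ in atTop, ∀ z ∈ Metric.sphere (0 : ℂ) t, ‖f z‖ ≤ C * t ^ d) :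
    ∃ p : Polynomial ℂ, ∀ z : ℂ, f z = p.eval z := by
  have hder (k : ℕ) (hk : d < k) : iteratedDeriv k f 0 = 0 := by
    rw [← norm_le_zero_iff]
    have hlim : Tendsto (fun t : ℝ => k.factorial * C * t⁻¹ ^ (k - d)) atTop (𝓝 0) := by
      simpa [zero_pow (show k - d ≠ 0 by omega)] using
        ((tendsto_inv_atTop_zero (𝕜 := ℝ)).pow (k - d)).const_mul (k.factorial * C)
    refine ge_of_tendsto_of_frequently hlim
      ((h.and_eventually (eventually_gt_atTop 0)).mono fun t ⟨ht, ht0⟩ => ?_)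
    refine (Complex.norm_iteratedDeriv_le_of_forall_mem_sphere_norm_le k ht0
      hf.diffContOnCl ht).trans (le_of_eq ?_)
    rw [show t ^ k = t ^ (k - d) * t ^ d by rw [← pow_add, Nat.sub_add_cancel hk.le], inv_pow]
    field_simp
  refine ⟨∑ k ∈ Finset.range (d + 1),
    Polynomial.monomial k ((k.factorial : ℂ)⁻¹ * iteratedDeriv k f 0), fun z => ?_⟩
  rw [← Complex.taylorSeries_eq_of_entire' (c := 0) (z := z) hf, Polynomial.eval_finsetSum, tsum_eq_sum]
  · refine Finset.sum_congr rfl fun k _ => ?_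
    simp
  · intro k hk
    rw [hder k (by simpa using hk)]
    simp

open Filter ValueDistribution in
lemma exists_polynomial_of_liminf_lt_top {ρ : ℝ → ℝ}
    (h : liminf (fun t : ℝ => ((ρ t / Real.log t : ℝ) : EReal)) atTop < ⊤) {f : ℂ → ℂ}
    (hf : Differentiable ℂ f) (hT : ∀ r : ℝ, 1 ≤ r → nevanlinnaT f r ≤ ρ r) :
    ∃ p : Polynomial ℂ, ∀ z : ℂ, f z = p.eval z := by
  obtain ⟨K, hK, -⟩ := EReal.lt_iff_exists_real_btwn.1 h
  have hm : Meromorphic f := fun z => (hf.analyticAt z).meromorphicAt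
  obtain ⟨d, hd⟩ := exists_nat_ge (3 * K)
  set L := Real.log ‖meromorphicTrailingCoeffAt f 0‖
  -- The radii below are `t / 4`, which accounts for the factor `4 ^ d`.
  refine exists_polynomial_of_frequently_norm_le hf (C := Real.exp (3 * L) * 4 ^ d) (d := d) ?_
  have hfreq := ((frequently_lt_of_liminf_lt (by isBoundedDefault) hK).and_eventually
    (eventually_gt_atTop (2 : ℝ)))
  have hquarter : Tendsto (fun t : ℝ => t / 4) atTop atTop :=
    tendsto_id.atTop_div_const (by norm_num)
  refine hquarter.frequently (hfreq.mono fun t ⟨ht, ht2⟩ z hz => ?_)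
  have hlog : 0 < Real.log t := Real.log_pos (by linarith)
  rw [EReal.coe_lt_coe_iff, div_lt_iff₀ hlog] at ht
  have hchar : characteristic f ⊤ t ≤ K * Real.log t + L := by
    have h1 := characteristic_sub_characteristic_inv_of_ne_zero hm (R := t) (by linarith)
    have h2 := characteristic_inv_le_nevanlinnaT f t
    have h3 := hT t (by linarith)
    linarith
  refine (norm_le_exp_of_characteristic hf ht2 (mem_sphere_zero_iff_norm.1 hz).le).trans ?_
  calc Real.exp (3 * characteristic f ⊤ t) ≤ Real.exp (3 * L + d * Real.log t) := by
        gcongr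
        nlinarith
    _ = Real.exp (3 * L) * 4 ^ d * (t / 4) ^ d := by
        rw [Real.exp_add, Real.exp_nat_mul, Real.exp_log (by linarith), div_pow]
        field_simp

section

open Filter Topology

/-! ### Canonical products of genus zero -/

/-- The canonical product of genus zero `z ↦ ∏ (1 - c n * z)`, for `∑ ‖c n‖ < ∞`. It is indexed by
the reciprocals `c n` of the zeros, so that a zero is removed by setting `c n` to `0`. -/
noncomputable def genusZeroProduct (c : ℕ → ℂ) (z : ℂ) : ℂ := ∏' n, (1 - c n * z)

namespace genusZeroProduct

variable {c : ℕ → ℂ}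

lemma multipliable (hc : Summable fun n => ‖c n‖) (z : ℂ) :
    Multipliable fun n => 1 - c n * z := by
  simp_rw [sub_eq_add_neg]
  apply multipliable_one_add_of_summable
  simpa using hc.mul_right ‖z‖

lemma tendsto_prod_range (hc : Summable fun n => ‖c n‖) (z : ℂ) :
    Tendsto (fun N => ∏ n ∈ Finset.range N, (1 - c n * z)) atTop (𝓝 (genusZeroProduct c z)) :=
  (multipliable hc z).hasProd.tendsto_prod_nat

lemma differentiable (hc : Summable fun n => ‖c n‖) : Differentiable ℂ (genusZeroProduct c) := by
  intro z
  have hprod : HasProdLocallyUniformlyOn (fun n z => 1 + -(c n * z))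
      (fun z => ∏' n, (1 + -(c n * z))) (Metric.ball (0 : ℂ) (‖z‖ + 1)) := by
    refine Summable.hasProdLocallyUniformlyOn_nat_one_add Metric.isOpen_ball
      (hc.mul_right (‖z‖ + 1)) (.of_forall fun n x hx => ?_) fun n => by fun_prop
    rw [norm_neg, norm_mul]
    gcongr
    exact (mem_ball_zero_iff.1 hx).le
  have hd := hprod.differentiableOn (.of_forall fun s => by
    simpa [Finset.prod_fn] using DifferentiableOn.finsetProd (fun _ _ => by fun_prop))
    Metric.isOpen_ball
  simp_rw [← sub_eq_add_neg] at hd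
  exact hd.differentiableAt (Metric.isOpen_ball.mem_nhds (by simp))

@[simp] lemma apply_zero : genusZeroProduct c 0 = 1 := by simp [genusZeroProduct]

lemma summable_update (hc : Summable fun n => ‖c n‖) (n : ℕ) :
    Summable fun k => ‖Function.update c n 0 k‖ := by
  refine hc.of_nonneg_of_le (fun _ => norm_nonneg _) fun k => ?_
  by_cases h : k = n
  · subst h; simp
  · simp [h]

/-- Splitting off the factor of the zero `1 / c n`. -/
lemma eq_mul_update (hc : Summable fun n => ‖c n‖) (n : ℕ) (z : ℂ) :
    genusZeroProduct c z = (1 - c n * z) * genusZeroProduct (Function.update c n 0) z := by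
  have h := (hasProd_ite_eq n (1 - c n * z)).mul (multipliable (summable_update hc n) z).hasProd
  refine HasProd.tprod_eq (?_ : HasProd _ ((1 - c n * z) * ∏' _, _))
  convert h using 2 with k
  by_cases hk : k = n
  · simp [hk]
  · simp [hk]

lemma hasDerivAt_of_mul_eq_one (hc : Summable fun n => ‖c n‖) {n : ℕ} {a : ℂ} (ha : c n * a = 1) :
    HasDerivAt (genusZeroProduct c) (-c n * genusZeroProduct (Function.update c n 0) a) a := by
  rw [funext (eq_mul_update hc n)]
  have h1 : HasDerivAt (fun z => 1 - c n * z) (-c n) a := by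
    simpa using ((hasDerivAt_id a).const_mul (c n)).const_sub 1
  refine (h1.fun_mul (differentiable (summable_update hc n) a).hasDerivAt).congr_deriv ?_
  rw [ha, sub_self, zero_mul, add_zero]

lemma norm_le {z : ℂ} {u : ℕ → ℝ} {S : ℝ} (hc : Summable fun n => ‖c n‖) (hu : HasSum u S)
    (hu0 : ∀ n, 0 ≤ u n)
    (h : ∀ n, 1 + ‖c n‖ * ‖z‖ ≤ Real.exp (u n)) : ‖genusZeroProduct c z‖ ≤ Real.exp S := by
  refine le_of_tendsto (tendsto_prod_range hc z).norm (.of_forall fun N => ?_)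
  rw [norm_prod]
  calc _ ≤ ∏ n ∈ Finset.range N, Real.exp (u n) := by
        gcongr with n _
        refine (norm_sub_le _ _).trans ?_
        simpa using h n
    _ = Real.exp (∑ n ∈ Finset.range N, u n) := (Real.exp_sum _ _).symm
    _ ≤ _ := by
        gcongr
        exact sum_le_hasSum _ (fun n _ => hu0 n) hu

end genusZeroProduct

section Lacunary

/-! ### Lacunary products are not Brody -/

variable {a : ℕ → ℝ}

lemma four_pow_mul_le (h4 : ∀ n, 4 * a n ≤ a (n + 1)) (n k : ℕ) :
    4 ^ k * a n ≤ a (n + k) := by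
  induction k with
  | zero => simp
  | succ k ih =>
    have := h4 (n + k)
    rw [pow_succ, ← add_assoc]
    linarith

lemma four_pow_le_lacunary (h1 : 1 ≤ a 0) (h4 : ∀ n, 4 * a n ≤ a (n + 1)) (n : ℕ) : (4 : ℝ) ^ n ≤ a n := by
  have := four_pow_mul_le h4 0 n
  rw [zero_add] at this
  nlinarith [pow_pos (show (0 : ℝ) < 4 by norm_num) n]

lemma lacunary_summable (h1 : 1 ≤ a 0) (h4 : ∀ n, 4 * a n ≤ a (n + 1)) :
    Summable fun n => ‖((a n : ℂ))⁻¹‖ := by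
  refine Summable.of_nonneg_of_le (fun _ => norm_nonneg _) (fun n => ?_)
    (summable_geometric_of_lt_one (r := (4 : ℝ)⁻¹) (by norm_num) (by norm_num))
  have h := four_pow_le_lacunary h1 h4 n
  rw [norm_inv, Complex.norm_real, inv_pow]
  gcongr
  exact h.trans (le_abs_self _)

/-- At the zero `a n` of a lacunary product, the partial products without the factor of `a n` are
at least of order `a n ^ 2`: the first two factors have size at least `a n / (2 * a k)` each, the
other factors with `k < n` have size at least `3`, and those with `k > n` differ from `1` by at most
`4 ^ (n - k)`. -/
lemma le_norm_prod_lacunary (h1 : 1 ≤ a 0) (h4 : ∀ n, 4 * a n ≤ a (n + 1)) {n : ℕ} (hn : 2 ≤ n)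
    (N : ℕ) (hN : n < N) :
    a n ^ 2 / (8 * a 0 * a 1) ≤
      ‖∏ k ∈ Finset.range N, (1 - Function.update (fun k => (a k : ℂ)⁻¹) n 0 k * a n)‖ := by
  have hpos (k : ℕ) : 0 < a k := lt_of_lt_of_le (by positivity) (four_pow_le_lacunary h1 h4 k)
  have hfac (k : ℕ) (hk : k ≠ n) :
      ‖1 - Function.update (fun k => (a k : ℂ)⁻¹) n 0 k * a n‖ = |1 - a n / a k| := by
    rw [Function.update_of_ne hk, ← Real.norm_eq_abs, ← Complex.norm_real]
    push_cast
    ring_nf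
  have hsmall (k : ℕ) (hk : k < n) : 4 * a k ≤ a n := by
    obtain ⟨j, rfl⟩ := Nat.exists_eq_add_of_lt hk
    have h := four_pow_mul_le h4 k (j + 1)
    have : (1 : ℝ) ≤ 4 ^ j := one_le_pow₀ (by norm_num)
    rw [pow_succ, ← add_assoc] at h
    nlinarith [mul_le_mul_of_nonneg_right this (hpos k).le]
  have hhead (m : ℕ) (hm : 2 ≤ m) (hmn : m ≤ n) : a n ^ 2 / (4 * a 0 * a 1) ≤
      ‖∏ k ∈ Finset.range m, (1 - Function.update (fun k => (a k : ℂ)⁻¹) n 0 k * a n)‖ := by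
    induction m, hm using Nat.le_induction with
    | base =>
      have key (k : ℕ) (hk : k < n) : a n / (2 * a k) ≤ |1 - a n / a k| := by
        have h := hsmall k hk
        refine le_trans ?_ (neg_le_abs _)
        have h2 : (4 : ℝ) ≤ a n / a k := by rwa [le_div_iff₀ (hpos k)]
        have h3 : a n / (2 * a k) = a n / a k / 2 := by
          rw [mul_comm, div_div]
        rw [h3]
        linarith
      rw [Finset.prod_range_succ, Finset.prod_range_one, norm_mul, hfac 0 (by omega),
        hfac 1 (by omega)]
      calc a n ^ 2 / (4 * a 0 * a 1) = a n / (2 * a 0) * (a n / (2 * a 1)) := by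
            have := (hpos 0).ne'
            have := (hpos 1).ne'
            field_simp
            norm_num
        _ ≤ _ := by
            gcongr
            · exact div_nonneg (hpos n).le (by linarith [hpos 1])
            · exact key 0 (by omega)
            · exact key 1 (by omega)
    | succ m hm ih =>
      rw [Finset.prod_range_succ, norm_mul, hfac m (by omega)]
      refine (ih (by omega)).trans (le_mul_of_one_le_right (norm_nonneg _) ?_)
      refine le_trans ?_ (neg_le_abs _)
      have h2 : (4 : ℝ) ≤ a n / a m := by
        rw [le_div_iff₀ (hpos m)]; exact hsmall m (by omega)
      linarith
  -- The factor `1 + 4⁻¹ ^ m` makes the induction work, since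
  -- `(1 + 4 * y) * (1 - y) ≥ 1 + y` for `y = 4⁻¹ ^ (m + 1) ≤ 1 / 4`.
  have htail (m : ℕ) : a n ^ 2 / (8 * a 0 * a 1) * (1 + (4 : ℝ)⁻¹ ^ m) ≤
      ‖∏ k ∈ Finset.range (n + 1 + m),
        (1 - Function.update (fun k => (a k : ℂ)⁻¹) n 0 k * a n)‖ := by
    induction m with
    | zero =>
      rw [add_zero, Finset.prod_range_succ, Function.update_self, zero_mul, sub_zero, mul_one]
      refine le_trans (le_of_eq ?_) (hhead n hn le_rfl)
      have := (hpos 0).ne'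
      have := (hpos 1).ne'
      rw [pow_zero]
      field_simp
      ring
    | succ m ih =>
      rw [← add_assoc, Finset.prod_range_succ, norm_mul, hfac _ (by omega)]
      have hq : a n / a (n + 1 + m) ≤ 4⁻¹ ^ (m + 1) := by
        rw [inv_pow, div_le_iff₀ (hpos _), inv_mul_eq_div, le_div_iff₀ (by positivity), mul_comm]
        simpa [add_assoc, add_comm 1] using four_pow_mul_le h4 n (m + 1)
      have hy : (0 : ℝ) < 4⁻¹ ^ (m + 1) := by positivity
      have hy' : (4 : ℝ)⁻¹ ^ (m + 1) ≤ 4⁻¹ := by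
        simpa using pow_le_pow_of_le_one (a := (4 : ℝ)⁻¹) (by norm_num) (by norm_num)
          (show 1 ≤ m + 1 by omega)
      have hA : 0 ≤ a n ^ 2 / (8 * a 0 * a 1) :=
        div_nonneg (sq_nonneg _) (by have := mul_pos (hpos 0) (hpos 1); nlinarith)
      have hm4 : (4 : ℝ)⁻¹ ^ m = 4 * 4⁻¹ ^ (m + 1) := by rw [pow_succ]; ring
      rw [hm4] at ih
      calc _ ≤ a n ^ 2 / (8 * a 0 * a 1) * (1 + 4 * 4⁻¹ ^ (m + 1)) * (1 - 4⁻¹ ^ (m + 1)) := by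
            rw [mul_assoc (_ / _)]
            refine mul_le_mul_of_nonneg_left ?_ hA
            nlinarith
        _ ≤ _ := by
            refine mul_le_mul ih ?_ (by linarith) (norm_nonneg _)
            exact (sub_le_sub_left hq 1).trans (le_abs_self _)
  obtain ⟨m, rfl⟩ := Nat.exists_eq_add_of_le (Nat.succ_le_of_lt hN)
  refine le_trans (le_mul_of_one_le_right ?_ ?_) (htail m)
  · exact div_nonneg (sq_nonneg _) (by have := mul_pos (hpos 0) (hpos 1); nlinarith)
  · linarith [show (0 : ℝ) < 4⁻¹ ^ m by positivity]

/-- At a zero the spherical derivative is the modulus of the derivative, and at the zeros `a n` of a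
lacunary product the latter grows at least like `a n`. -/
lemma not_isBrody_lacunary (h1 : 1 ≤ a 0) (h4 : ∀ n, 4 * a n ≤ a (n + 1)) :
    ¬ IsBrody (genusZeroProduct fun n => (a n : ℂ)⁻¹) := by
  have hpos (k : ℕ) : 0 < a k := lt_of_lt_of_le (by positivity) (four_pow_le_lacunary h1 h4 k)
  have hc := lacunary_summable h1 h4
  rintro ⟨B, hB⟩
  have hbd (n : ℕ) (hn : 2 ≤ n) : a n / (8 * a 0 * a 1) ≤ B := by
    have hne : (a n : ℂ)⁻¹ * a n = 1 := inv_mul_cancel₀ (by exact_mod_cast (hpos n).ne')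
    refine le_trans ?_ (hB ⟨a n, rfl⟩)
    have hz : genusZeroProduct (fun n => (a n : ℂ)⁻¹) (a n) = 0 := by
      rw [genusZeroProduct.eq_mul_update hc n, hne, sub_self, zero_mul]
    rw [sphericalDeriv, (genusZeroProduct.hasDerivAt_of_mul_eq_one hc hne).deriv, hz]
    have hG : a n ^ 2 / (8 * a 0 * a 1) ≤
        ‖genusZeroProduct (Function.update (fun n => (a n : ℂ)⁻¹) n 0) (a n)‖ :=
      ge_of_tendsto (genusZeroProduct.tendsto_prod_range
        (genusZeroProduct.summable_update hc n) _).norm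
        ((eventually_gt_atTop n).mono fun N hN => le_norm_prod_lacunary h1 h4 hn N hN)
    simp only [norm_mul, norm_neg, norm_inv, Complex.norm_real, Real.norm_of_nonneg (hpos n).le,
      norm_zero]
    rw [zero_pow two_ne_zero, add_zero, div_one, le_inv_mul_iff₀ (hpos n)]
    refine le_trans (le_of_eq ?_) hG
    ring
  have h8 : 0 < 8 * a 0 * a 1 := by have := mul_pos (hpos 0) (hpos 1); nlinarith
  have hlim : Tendsto (fun n => a n / (8 * a 0 * a 1)) atTop atTop :=
    (tendsto_atTop_mono (four_pow_le_lacunary h1 h4)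
      (tendsto_pow_atTop_atTop_of_one_lt (by norm_num))).atTop_div_const h8
  obtain ⟨n, hn, hn'⟩ := ((hlim.eventually_gt_atTop B).and (eventually_ge_atTop 2)).exists
  exact absurd (hbd n hn') (not_le.2 hn)

end Lacunary

/-! ### Lacunary products of small growth -/

/-- If `ρ` grows faster than `log`, a zero placed far enough from the origin costs at most a
prescribed fraction of `ρ` on every circle of radius at least `1`: for large radii because
`log (1 + r) = o(ρ r)`, for the others because `ρ` is bounded below by `ρ 1 > 0`. -/
lemma eventually_one_add_div_le_exp {ρ : ℝ → ℝ} (hρ_mono : MonotoneOn ρ (Set.Ici 1))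
    (hρ_pos : ∀ t : ℝ, 1 ≤ t → 0 < ρ t)
    (h : liminf (fun t : ℝ => ((ρ t / Real.log t : ℝ) : EReal)) atTop = ⊤) {ε : ℝ} (hε : 0 < ε) :
    ∀ᶠ a : ℝ in atTop, ∀ r : ℝ, 1 ≤ r → 1 + r / a ≤ Real.exp (ε * ρ r) := by
  have hK : ∀ᶠ t : ℝ in atTop, ((2 / ε : ℝ) : EReal) < ((ρ t / Real.log t : ℝ) : EReal) :=
    eventually_lt_of_lt_liminf (by rw [h]; exact EReal.coe_lt_top _)
  obtain ⟨R, hR⟩ := eventually_atTop.1 (hK.and (eventually_ge_atTop 2))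
  have hR2 : 2 ≤ R := (hR R le_rfl).2
  have hρ1 := hρ_pos 1 le_rfl
  filter_upwards [eventually_ge_atTop 1, eventually_ge_atTop (R / (ε * ρ 1))] with a ha1 ha r hr
  rcases le_total r R with hrR | hrR
  · refine le_trans ?_ (Real.add_one_le_exp _)
    rw [add_comm]
    gcongr
    rw [div_le_iff₀ (by linarith)]
    rw [div_le_iff₀ (by positivity)] at ha
    have := hρ_mono (Set.mem_Ici.2 le_rfl) (Set.mem_Ici.2 hr) hr
    calc r ≤ R := hrR
      _ ≤ a * (ε * ρ 1) := ha
      _ ≤ a * (ε * ρ r) := by gcongr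
      _ = _ := mul_comm _ _
  · obtain ⟨hlt, hr2⟩ := hR r hrR
    rw [EReal.coe_lt_coe_iff, lt_div_iff₀ (Real.log_pos (by linarith)), div_mul_eq_mul_div,
      div_lt_iff₀ hε] at hlt
    calc 1 + r / a ≤ 1 + r := by gcongr; exact div_le_self (by linarith) ha1
      _ ≤ r ^ 2 := by nlinarith
      _ = Real.exp (2 * Real.log r) := by
        rw [two_mul, Real.exp_add, Real.exp_log (by linarith), sq]
      _ ≤ _ := Real.exp_le_exp.2 (by linarith)

lemma exists_lacunary {P : ℕ → ℝ → Prop} (hP : ∀ n, ∀ᶠ x in atTop, P n x) :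
    ∃ a : ℕ → ℝ, 1 ≤ a 0 ∧ (∀ n, 4 * a n ≤ a (n + 1)) ∧ ∀ n, P n (a n) := by
  have hex (n : ℕ) (x : ℝ) : ∃ y, 4 * x ≤ y ∧ P n y :=
    ((eventually_ge_atTop (4 * x)).and (hP n)).exists
  choose g hg hgP using hex
  refine ⟨fun n => Nat.rec (g 0 1) (fun n x => g (n + 1) x) n, ?_, fun n => hg _ _, fun n => ?_⟩
  · exact le_trans (by norm_num) (hg 0 1)
  · cases n <;> exact hgP _ _

open ValueDistribution in
/-- By the first main theorem, `T_f(r)` is at most `2π` times the logarithm of the maximum modulus;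
the normalization `f 0 = 1` removes the additive constant. -/
lemma nevanlinnaT_le_of_norm_le_exp {f : ℂ → ℂ} (hf : Differentiable ℂ f) (hf0 : f 0 = 1) {r M : ℝ}
    (hr : 1 ≤ r) (hM : 0 ≤ M) (h : ∀ z ∈ Metric.sphere (0 : ℂ) r, ‖f z‖ ≤ Real.exp M) :
    nevanlinnaT f r ≤ 2 * Real.pi * M := by
  refine (nevanlinnaT_le_characteristic_inv f hr).trans ?_
  have hm : Meromorphic f := fun z => (hf.analyticAt z).meromorphicAt
  have h1 := characteristic_sub_characteristic_inv_of_ne_zero hm (R := r) (by linarith)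
  rw [(hf.analyticAt 0).meromorphicTrailingCoeffAt_of_ne_zero (by simp [hf0]), hf0, norm_one,
    Real.log_one, sub_eq_zero] at h1
  rw [← h1, characteristic, Pi.add_apply]
  have hpole : logCounting f ⊤ = 0 := by
    have hdiv : 0 ≤ MeromorphicOn.divisor f Set.univ :=
      MeromorphicOn.AnalyticOnNhd.divisor_nonneg fun z _ => hf.analyticAt z
    rw [logCounting_top, negPart_eq_zero.2 hdiv, map_zero]
  have hprox : proximity f ⊤ r ≤ M := by
    rw [proximity_top]
    refine Real.circleAverage_mono_on_of_le_circle
      hm.meromorphicOn.circleIntegrable_posLog_norm fun z hz => ?_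
    rw [abs_of_pos (by linarith)] at hz
    calc Real.posLog ‖f z‖ ≤ Real.posLog (Real.exp M) :=
          Real.posLog_le_posLog (norm_nonneg _) (h z hz)
      _ = M := (congrArg (max 0) (Real.log_exp M)).trans (max_eq_right hM)
  rw [hpole, Pi.zero_apply, add_zero]
  gcongr

lemma exists_not_isBrody_of_liminf_eq_top {ρ : ℝ → ℝ} (hρ_mono : MonotoneOn ρ (Set.Ici 1))
    (hρ_pos : ∀ t : ℝ, 1 ≤ t → 0 < ρ t)
    (h : liminf (fun t : ℝ => ((ρ t / Real.log t : ℝ) : EReal)) atTop = ⊤) :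
    ∃ f : ℂ → ℂ, Differentiable ℂ f ∧ f 0 ≠ 0 ∧ ¬ IsBrody f ∧
      ∀ r : ℝ, 1 ≤ r → nevanlinnaT f r ≤ ρ r := by
  -- The factor of `a n` is allotted the share `2 ^ (-(n + 1))` of the bound `ρ r / (2π)`.
  obtain ⟨a, h1, h4, ha⟩ := exists_lacunary fun n : ℕ =>
    eventually_one_add_div_le_exp hρ_mono hρ_pos h
      (show 0 < 1 / (2 * Real.pi) / 2 / 2 ^ n by positivity)
  have hc := lacunary_summable h1 h4
  refine ⟨genusZeroProduct fun n => (a n : ℂ)⁻¹, genusZeroProduct.differentiable hc, by simp,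
    not_isBrody_lacunary h1 h4, fun r hr => ?_⟩
  have hρr := hρ_pos r hr
  have hle := nevanlinnaT_le_of_norm_le_exp (genusZeroProduct.differentiable hc)
    genusZeroProduct.apply_zero hr (M := ρ r / (2 * Real.pi)) (by positivity) fun z hz => by
      refine genusZeroProduct.norm_le hc (hasSum_geometric_two' _) (fun n => by positivity)
        fun n => ?_
      have han : 0 < a n := lt_of_lt_of_le (by positivity) (four_pow_le_lacunary h1 h4 n)
      rw [mem_sphere_zero_iff_norm.1 hz, norm_inv, Complex.norm_real, Real.norm_of_nonneg han.le,
        inv_mul_eq_div]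
      refine (ha n r hr).trans (le_of_eq ?_)
      congr 1
      ring
  rwa [mul_div_cancel₀ _ (by positivity)] at hle

end

theorem theorem2 (ρ : ℝ → ℝ)
    (hρ_cont : ContinuousOn ρ (Set.Ici 1))
    (hρ_mono : MonotoneOn ρ (Set.Ici 1))
    (hρ_pos : ∀ t : ℝ, 1 ≤ t → 0 < ρ t) :
    (Filter.liminf (fun t : ℝ => ((ρ t / Real.log t : ℝ) : EReal)) Filter.atTop < ⊤ →
      ∀ f : ℂ → ℂ, Differentiable ℂ f →
        (∀ r : ℝ, 1 ≤ r → nevanlinnaT f r ≤ ρ r) →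
        ∃ p : Polynomial ℂ, ∀ z : ℂ, f z = p.eval z) ∧
    (Filter.liminf (fun t : ℝ => ((ρ t / Real.log t : ℝ) : EReal)) Filter.atTop = ⊤ →
      ∃ f : ℂ → ℂ, Differentiable ℂ f ∧ f 0 ≠ 0 ∧ ¬ IsBrody f ∧
        ∀ r : ℝ, 1 ≤ r → nevanlinnaT f r ≤ ρ r) :=
  ⟨fun h _ hf hT => exists_polynomial_of_liminf_lt_top h hf hT,
    exists_not_isBrody_of_liminf_eq_top hρ_mono hρ_pos⟩
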